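/- **Proposition.** For a finitely supported function $f:\mathbb{Z}\to[0,\infty)$ with support $\{x: f(x)>0\}=\{x_0<x_1<\cdots<x_n\}$, let $f^{\#}:\mathbb{Z}\to[0,\infty)$ be defined by $f^{\#}(r)=f(x_r)$ for $r\in\{0,\dots,n\}$ and $f^{\#}(k)=0$ for all other integers $k$. Call $f$ *$\#$-log-concave* if $f^{\#}(i)^2\ge f^{\#}(i-1)f^{\#}(i+1)$ for all $i\in\mathbb{Z}$. An integer-valued random variable $X$ with finitely supported probability mass function $f$ is called $\#$-log-concave if $f$ is, and $X^{\#}$ denotes a random variable with probability mass function $f^{\#}$. For an integer-valued random variable $X$ with finitely supported probability mass function $f$, the Rényi entropy of order $\alpha\in[0,\infty]$ is $$H_\alpha(X)=\frac{1}{1-\alpha}\log\Big(\sum_{i\in\mathbb{Z}}f(i)^\alpha\Big)\quad(\alpha\in(0,1)\cup(1,\infty)),$$ $$H_0(X)=\log|\{i\in\mathbb{Z}: f(i)>0\}|,\qquad H_1(X)=-\sum_{i\in\mathbb{Z}}f(i)\log f(i),\qquad H_\infty(X)=-\log\sup_{i\in\mathbb{Z}}f(i),$$ with the convention $0\log 0=0$.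 Let $X_1,\dots,X_N$ be independent integer-valued random variables with finite support, each of them $\#$-log-concave, and let $X_1^{\#},\dots,X_N^{\#}$ be independent random variables, where $X_i^{\#}$ has probability mass function $f_i^{\#}$ and $f_i$ is the probability mass function of $X_i$. Then, for every $\alpha\in[0,\infty]$, $$H_\alpha(X_1+\cdots+X_N)\ \ge\ H_\alpha(X_1^{\#}+\cdots+X_N^{\#}).$$ -/

import Mathlib

open MeasureTheory ProbabilityTheory
open scoped ENNReal

noncomputable section

/-- The probability mass function `k ↦ P(X = k)` of an integer-valued random variable. -/
def massFun {Ω : Type*} [MeasurableSpace Ω] (P : Measure Ω) (X : Ω → ℤ) : ℤ → ℝ :=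
  fun k => P.real (X ⁻¹' {k})

/-- The support `{x : f x > 0}` of a non-negative function on the integers. -/
def posSupp (f : ℤ → ℝ) : Set ℤ := {x | 0 < f x}

/-- The squeezed rearrangement `f^#` of a finitely supported non-negative function: if the support
of `f` is `{x₀ < ⋯ < xₙ}`, then `f^#` takes the value `f (x_r)` at `r` for `r = 0, …, n`,
and vanishes elsewhere. -/
def hashFun (f : ℤ → ℝ) (hf : (posSupp f).Finite) : ℤ → ℝ :=
  fun k => ∑ r : Fin hf.toFinset.card,
    if k = ((r : ℕ) : ℤ) then f (hf.toFinset.orderEmbOfFin rfl r) else 0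

/-- Log-concavity of a function on the integers. -/
def IsLogConcaveInt (f : ℤ → ℝ) : Prop :=
  ∀ i : ℤ, f (i - 1) * f (i + 1) ≤ f i ^ 2

/-- A finitely supported non-negative function `f` is `#`-log-concave if `f^#` is log-concave. -/
def IsHashLogConcave (f : ℤ → ℝ) (hf : (posSupp f).Finite) : Prop :=
  IsLogConcaveInt (hashFun f hf)

/-- The Rényi entropy of order `α ∈ [0, ∞]` of a probability mass function on the integers. It is
only used for finitely supported mass functions, for which it is a finite real number. -/
def renyiEntropyOfMass (α : ℝ≥0∞) (f : ℤ → ℝ) : ℝ :=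
  if α = 0 then Real.log ((posSupp f).ncard : ℝ)
  else if α = 1 then ∑' i : ℤ, -(f i * Real.log (f i))
  else if α = ∞ then -Real.log (⨆ i : ℤ, f i)
  else 1 / (1 - α.toReal) * Real.log (∑' i : ℤ, f i ^ α.toReal)

/-- The Rényi entropy `H_α(X)` of an integer-valued random variable. -/
def renyiEntropy {Ω : Type*} [MeasurableSpace Ω] (α : ℝ≥0∞) (P : Measure Ω) (X : Ω → ℤ) : ℝ :=
  renyiEntropyOfMass α (massFun P X)

end

/-!
Let `ν₁`, `ν₂` be log-concave laws on `ℤ`, and let `U`, `V` be independent with these laws. As `r`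
increases, the conditional laws of `V` and of `U = r - V` given `U + V = r` both increase in the
likelihood ratio order, hence stochastically. Realizing them by quantile functions at a common
uniform level writes the law of `(U, V)` as a mixture of images of the law of `U + V` under strictly
increasing maps `ℤ → ℤ × ℤ`. The law of `Xᵢ` is the image of the law of `Xᵢ^#` under a strictly
increasing map, and addition `ℤ × ℤ → ℤ` is strictly increasing, so by induction the law of `∑ Xᵢ`
is a mixture of strictly increasing images of the law of `∑ Xᵢ^#`.

Only the injectivity of these maps matters for the entropy: averaging the incidence matrices of
injections gives a doubly substochastic matrix, so the first law is majorized by the second, and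
Rényi entropies are monotone under majorization.
-/

open Set Function
open scoped unitInterval Pointwise

section RealLogConcave

variable {f : ℤ → ℝ}

theorem IsLogConcaveInt.mul_le_mul_of_le (hf : IsLogConcaveInt f) (hf₀ : ∀ x, 0 ≤ f x)
    (hsupp : (posSupp f).OrdConnected) {a b : ℤ} (hab : a ≤ b) :
    f (a - 1) * f (b + 1) ≤ f a * f b := by
  induction b, hab using Int.leInduction with
  | base => simpa only [sq] using hf a
  | succ b hab ih =>
    rcases (hf₀ (a - 1)).eq_or_lt with h | hleft
    · simpa only [← h, zero_mul] using mul_nonneg (hf₀ _) (hf₀ _)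
    rcases (hf₀ (b + 1 + 1)).eq_or_lt with h | hright
    · simpa only [← h, mul_zero] using mul_nonneg (hf₀ _) (hf₀ _)
    have hb : 0 < f b := hsupp.out hleft hright ⟨by omega, by omega⟩
    have hb' : 0 < f (b + 1) := hsupp.out hleft hright ⟨by omega, by omega⟩
    have hlast : f b * f (b + 1 + 1) ≤ f (b + 1) ^ 2 := by simpa using hf (b + 1)
    refine le_of_mul_le_mul_right ?_ (mul_pos hb hb')
    calc f (a - 1) * f (b + 1 + 1) * (f b * f (b + 1))
        = f (a - 1) * f (b + 1) * (f b * f (b + 1 + 1)) := by ring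
      _ ≤ f a * f b * f (b + 1) ^ 2 :=
          mul_le_mul ih hlast (mul_nonneg (hf₀ _) (hf₀ _)) (mul_nonneg (hf₀ _) (hf₀ _))
      _ = f a * f (b + 1) * (f b * f (b + 1)) := by ring

theorem IsLogConcaveInt.mul_le_mul_of_add_eq_add (hf : IsLogConcaveInt f) (hf₀ : ∀ x, 0 ≤ f x)
    (hsupp : (posSupp f).OrdConnected) {a b c d : ℤ} (hab : a ≤ b) (hbd : b ≤ d)
    (hsum : a + d = b + c) : f a * f d ≤ f b * f c := by
  have spread (x y : ℤ) (n : ℕ) (hxy : x ≤ y) : f (x - n) * f (y + n) ≤ f x * f y := by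
    induction n with
    | zero => simp
    | succ n ih =>
      refine le_trans ?_ ih
      have := hf.mul_le_mul_of_le hf₀ hsupp (show x - n ≤ y + n by omega)
      simpa only [Nat.cast_succ, sub_sub, add_assoc] using this
  rcases le_total b c with hbc | hcb
  · convert spread b c (b - a).toNat hbc using 3 <;> omega
  · rw [mul_comm (f b)]
    convert spread c b (d - b).toNat hcb using 3 <;> omega

end RealLogConcave

section Chebyshev

theorem tsum_mul_tsum_le_tsum_mul_tsum {ι : Type*} [LinearOrder ι] {u v s t : ι → ℝ≥0∞}
    (huv : ∀ m n, m < n → v m * u n ≤ u m * v n) (hst : ∀ m n, m < n → t m * s n ≤ s m * t n) :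
    (∑' m, u m * t m) * (∑' n, v n * s n) ≤ (∑' m, u m * s m) * (∑' n, v n * t n) := by
  have rearrange {a a' b b' : ℝ≥0∞} (ha : a' ≤ a) (hb : b' ≤ b) :
      a * b' + a' * b ≤ a * b + a' * b' := by
    obtain ⟨e, rfl⟩ := exists_add_of_le ha
    calc (a' + e) * b' + a' * b = e * b' + (a' * b + a' * b') := by ring
      _ ≤ e * b + (a' * b + a' * b') := by gcongr
      _ = (a' + e) * b + a' * b' := by ring
  have pairs (m n : ι) : u m * t m * (v n * s n) + u n * t n * (v m * s m)
      ≤ u m * s m * (v n * t n) + u n * s n * (v m * t m) := by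
    rcases lt_trichotomy m n with h | rfl | h
    · convert rearrange (huv m n h) (hst m n h) using 1 <;> ring
    · exact le_of_eq (by ring)
    · convert rearrange (huv n m h) (hst n m h) using 1 <;> ring
  have double (p q : ι → ℝ≥0∞) :
      ∑' m, ∑' n, (p m * q n + p n * q m) = 2 * ((∑' m, p m) * ∑' n, q n) := by
    simp only [ENNReal.tsum_add, ENNReal.tsum_mul_left, ENNReal.tsum_mul_right]
    ring
  refine (ENNReal.mul_le_mul_iff_right two_ne_zero ENNReal.ofNat_ne_top).1 ?_
  rw [← double, ← double]
  exact ENNReal.tsum_le_tsum fun m ↦ ENNReal.tsum_le_tsum fun n ↦ pairs m n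

end Chebyshev

section LogConcaveMeasure

/-- Log-concavity of a measure on `ℤ`, in the total positivity form: moving a pair of points of
fixed sum closer together does not decrease the product of their masses. For finite measures this
is log-concavity of the mass function together with the absence of internal zeros. -/
def IsLogConcaveMeasure (ν : Measure ℤ) : Prop :=
  ∀ ⦃a b c d : ℤ⦄, a ≤ b → b ≤ d → a + d = b + c → ν {a} * ν {d} ≤ ν {b} * ν {c}

theorem isLogConcaveMeasure_dirac_zero : IsLogConcaveMeasure (Measure.dirac 0) := by
  intro a b c d hab hbd hsum
  by_cases h : a = 0 ∧ d = 0
  · obtain rfl : b = 0 := by omega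
    obtain rfl : c = 0 := by omega
    simp [h]
  · rcases not_and_or.1 h with h | h <;> simp [h]

theorem conv_singleton (ν₁ ν₂ : Measure ℤ) [SFinite ν₁] [SFinite ν₂] (r : ℤ) :
    (ν₁ ∗ ν₂) {r} = ∑' j, ν₁ {r - j} * ν₂ {j} := by
  rw [Measure.conv, Measure.map_apply measurable_add (measurableSet_singleton r),
    Measure.prod_apply_symm (measurable_add (measurableSet_singleton r)), lintegral_countable']
  refine tsum_congr fun j ↦ congrArg (ν₁ · * ν₂ {j}) ?_
  ext i
  simp [eq_sub_iff_add_eq]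

theorem IsLogConcaveMeasure.conv {ν₁ ν₂ : Measure ℤ} [SFinite ν₁] [SFinite ν₂]
    (h₁ : IsLogConcaveMeasure ν₁) (h₂ : IsLogConcaveMeasure ν₂) :
    IsLogConcaveMeasure (ν₁ ∗ ν₂) := by
  intro a b c d hab hbd hsum
  have reindex (i j : ℤ) : (ν₁ ∗ ν₂) {i} = ∑' m, ν₁ {j - m} * ν₂ {m - (j - i)} := by
    rw [conv_singleton, ← (Equiv.subRight (j - i)).tsum_eq]
    simp only [Equiv.subRight_apply, show ∀ m, i - (m - (j - i)) = j - m by intro m; ring]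
  rw [reindex a b, conv_singleton ν₁ ν₂ d, conv_singleton ν₁ ν₂ b, reindex c d,
    show d - c = b - a by omega]
  refine tsum_mul_tsum_le_tsum_mul_tsum (fun m n hmn ↦ ?_) fun m n hmn ↦ ?_
  · rw [mul_comm, mul_comm (ν₁ {b - m})]
    exact h₁ (by omega) (by omega) (by omega)
  · rcases le_total m (n - (b - a)) with _ | _
    · exact h₂ (by omega) (by omega) (by omega)
    · rw [mul_comm (ν₂ {m})]
      exact h₂ (by omega) (by omega) (by omega)

end LogConcaveMeasure

section Quantile

-- Dominance in the likelihood ratio order implies stochastic dominance.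
theorem measure_Iic_le_of_mul_le_mul {ρ ρ' : Measure ℤ} [IsProbabilityMeasure ρ]
    [IsProbabilityMeasure ρ'] (k : ℤ)
    (h : ∀ x y, x < y → ρ' {x} * ρ {y + k} ≤ ρ {x + k} * ρ' {y}) (i : ℤ) :
    ρ' (Iic i) ≤ ρ (Iic (i + k)) := by
  have total (τ : Measure ℤ) [IsProbabilityMeasure τ] : ∑' x, τ {x} = 1 := by
    simpa using τ.tsum_indicator_apply_singleton univ MeasurableSet.univ
  have partial_sum (τ : Measure ℤ) (j : ℤ) :
      ∑' x, τ {x} * (Iic j).indicator 1 x = τ (Iic j) := by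
    rw [← τ.tsum_indicator_apply_singleton _ measurableSet_Iic]
    refine tsum_congr fun x ↦ ?_
    by_cases hx : x ≤ j <;> simp [hx]
  have shift (F : ℤ → ℝ≥0∞) : ∑' x, F (x + k) = ∑' x, F x := (Equiv.addRight k).tsum_eq F
  have key := tsum_mul_tsum_le_tsum_mul_tsum (u := fun x ↦ ρ {x + k}) (v := fun x ↦ ρ' {x})
    (s := (Iic i).indicator 1) (t := 1) h fun m n hmn ↦ by
      by_cases hn : n ≤ i
      · simp [hn, hmn.le.trans hn]
      · simp only [indicator_of_notMem (show n ∉ Iic i from hn), mul_zero, zero_le]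
  have shifted_sum : ∑' x, ρ {x + k} * (Iic i).indicator 1 x = ρ (Iic (i + k)) := by
    rw [← partial_sum, ← shift fun x ↦ ρ {x} * (Iic (i + k)).indicator 1 x]
    refine tsum_congr fun x ↦ ?_
    by_cases hx : x ≤ i <;> simp [hx]
  have shifted_total : ∑' x, ρ {x + k} = 1 := (shift fun x ↦ ρ {x}).trans (total ρ)
  simpa only [Pi.one_apply, mul_one, shifted_total, total, one_mul, partial_sum, shifted_sum]
    using key

/-- The quantile function (generalized inverse of the distribution function) of a probability
measure on `ℤ`. Only its values at levels in `(0, 1)` are meaningful. -/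
noncomputable def quantile (ρ : Measure ℤ) (u : I) : ℤ :=
  sInf {i | ENNReal.ofReal u ≤ ρ (Iic i)}

variable {ρ ρ' : Measure ℤ} [IsProbabilityMeasure ρ] [IsProbabilityMeasure ρ']

theorem quantile_le_iff {u : I} (hu : u ∈ Ioo (0 : I) 1) {i : ℤ} :
    quantile ρ u ≤ i ↔ ENNReal.ofReal u ≤ ρ (Iic i) := by
  have hu₀ : 0 < ENNReal.ofReal u := ENNReal.ofReal_pos.2 hu.1
  have hu₁ : ENNReal.ofReal u < ρ univ := by
    simpa using ENNReal.ofReal_lt_one.2 hu.2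
  obtain ⟨top, htop⟩ := ((tendsto_measure_Iic_atTop ρ).eventually_const_le hu₁).exists
  have tendsto_zero : Filter.Tendsto (fun i ↦ ρ (Iic i)) Filter.atBot (nhds 0) := by
    rw [← measure_empty (μ := ρ), ← iInter_Iic_eq_empty_iff (f := id).2 (by simp)]
    exact tendsto_measure_iInter_atBot (fun _ ↦ measurableSet_Iic.nullMeasurableSet)
      (fun _ _ ↦ Iic_subset_Iic.2) ⟨0, measure_ne_top _ _⟩
  obtain ⟨bot, hbot⟩ := (tendsto_zero.eventually_lt_const hu₀).exists
  have hbdd : BddBelow {i | ENNReal.ofReal u ≤ ρ (Iic i)} :=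
    ⟨bot, fun j hj ↦ le_of_not_ge fun hjb ↦
      (hj.trans (measure_mono (Iic_subset_Iic.2 hjb))).not_gt hbot⟩
  refine ⟨fun h ↦ ?_, fun h ↦ csInf_le hbdd h⟩
  have hmem : quantile ρ u ∈ {i | ENNReal.ofReal u ≤ ρ (Iic i)} := Int.csInf_mem ⟨top, htop⟩ hbdd
  exact hmem.trans (measure_mono (Iic_subset_Iic.2 h))

theorem ae_mem_Ioo_zero_one : ∀ᵐ u : I, u ∈ Ioo (0 : I) 1 := by
  filter_upwards [compl_mem_ae_iff.2 (measure_singleton (0 : I)),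
    compl_mem_ae_iff.2 (measure_singleton (1 : I))] with u h₀ h₁
  exact ⟨unitInterval.pos_iff_ne_zero.2 h₀, unitInterval.lt_one_iff_ne_one.2 h₁⟩

theorem measurable_quantile : Measurable (quantile ρ) := by
  refine measurable_of_Iic fun i ↦ ?_
  have hsplit : quantile ρ ⁻¹' Iic i =
      {u : I | ENNReal.ofReal u ≤ ρ (Iic i)} ∩ Ioo 0 1 ∪ quantile ρ ⁻¹' Iic i ∩ {0, 1} := by
    ext u
    have hu : u ∈ Ioo (0 : I) 1 ∨ u ∈ ({0, 1} : Set I) := by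
      simp only [mem_Ioo, unitInterval.pos_iff_ne_zero, unitInterval.lt_one_iff_ne_one,
        mem_insert_iff, mem_singleton_iff]
      tauto
    by_cases h : u ∈ Ioo (0 : I) 1
    · have : u ∉ ({0, 1} : Set I) := by rintro (rfl | rfl) <;> simp at h
      simp [quantile_le_iff h, h.1, h.2, this]
    · simp [h, hu.resolve_left h]
  rw [hsplit]
  refine ((measurableSet_le ?_ measurable_const).inter measurableSet_Ioo).union
    (((toFinite {0, 1}).subset inter_subset_right).measurableSet)
  fun_prop

theorem map_quantile : volume.map (quantile ρ) = ρ := by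
  have := Measure.isProbabilityMeasure_map (μ := (volume : Measure I))
    (measurable_quantile (ρ := ρ)).aemeasurable
  refine Measure.ext_of_Iic _ _ fun i ↦ ?_
  have hmem : (ρ (Iic i)).toReal ∈ I := ⟨measureReal_nonneg, measureReal_le_one⟩
  have hae : quantile ρ ⁻¹' Iic i =ᵐ[volume] Iic (⟨_, hmem⟩ : I) := by
    filter_upwards [ae_mem_Ioo_zero_one] with u hu
    refine propext ((quantile_le_iff hu).trans ?_)
    exact ENNReal.ofReal_le_iff_le_toReal (measure_ne_top _ _)
  rw [Measure.map_apply measurable_quantile measurableSet_Iic, measure_congr hae,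
    unitInterval.volume_Iic]
  exact ENNReal.ofReal_toReal (measure_ne_top _ _)

theorem quantile_le_quantile_add {k : ℤ} (h : ∀ i, ρ' (Iic i) ≤ ρ (Iic (i + k))) {u : I}
    (hu : u ∈ Ioo (0 : I) 1) : quantile ρ u ≤ quantile ρ' u + k :=
  (quantile_le_iff hu).2 (((quantile_le_iff hu).1 le_rfl).trans (h _))

end Quantile

section MonoMixture

/-- The set of points of positive mass of a measure. -/
def atoms {α : Type*} [MeasurableSpace α] (ν : Measure α) : Set α := {a | ν {a} ≠ 0}

theorem atoms_prod {α β : Type*} [MeasurableSpace α] [MeasurableSpace β] (ν : Measure α)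
    (ρ : Measure β) [SFinite ρ] : atoms (ν.prod ρ) = atoms ν ×ˢ atoms ρ := by
  ext ⟨a, b⟩
  simp [atoms, ← singleton_prod_singleton, Measure.prod_prod]

variable {α β γ δ : Type*} [MeasurableSpace α] [MeasurableSpace β] [MeasurableSpace γ]
  [MeasurableSpace δ]

theorem measurePreserving_of_injOn_atoms [Countable α] [Countable β]
    [MeasurableSingletonClass β] {ν : Measure α} {π : Measure β} {t : α → β}
    (ht : Measurable t) (hinj : InjOn t (atoms ν)) (hmass : ∀ a ∈ atoms ν, π {t a} = ν {a})
    (hsurj : atoms π ⊆ t '' atoms ν) :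
    MeasurePreserving t ν π := by
  refine ⟨ht, Measure.ext_of_singleton fun b ↦ ?_⟩
  rw [Measure.map_apply ht (measurableSet_singleton b)]
  by_cases hb : b ∈ atoms π
  · obtain ⟨a, ha, rfl⟩ := hsurj hb
    rw [hmass a ha]
    refine measure_congr ?_
    filter_upwards [ae_iff_of_countable.2 fun _ ↦ id] with x hx using
      propext (hinj.eq_iff hx ha)
  · rw [not_not.1 hb, measure_eq_zero_iff_ae_notMem]
    refine ae_iff_of_countable.2 fun x hx hxb ↦ hb ?_
    exact mem_singleton_iff.1 hxb ▸ (hmass x hx).trans_ne hx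

/-- `π` is a monotone mixture of `ν` if it is an average of images of `ν` under random maps that
are almost surely strictly increasing on the atoms of `ν`. Taking the probability space `Λ` in the
lowest universe loses nothing here, as only finite products of `[0, 1]` are needed. -/
def IsMonoMixture [Preorder α] [Preorder β] (π : Measure β) (ν : Measure α) : Prop :=
  ∃ (Λ : Type) (_ : MeasurableSpace Λ) (μ : Measure Λ) (_ : IsProbabilityMeasure μ)
    (T : Λ → α → β), MeasurePreserving (uncurry T) (μ.prod ν) π ∧
      ∀ᵐ l ∂μ, StrictMonoOn (T l) (atoms ν)

theorem IsMonoMixture.of_strictMonoOn [Preorder α] [Preorder β] {ν : Measure α} {π : Measure β}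
    [SFinite ν] {t : α → β} (ht : MeasurePreserving t ν π) (hmono : StrictMonoOn t (atoms ν)) :
    IsMonoMixture π ν :=
  ⟨Unit, inferInstance, Measure.dirac (), inferInstance, fun _ ↦ t,
    ht.comp measurePreserving_snd, .of_forall fun _ ↦ hmono⟩

theorem ae_mapsTo_atoms [Countable α] [Countable β] {Λ : Type*} [MeasurableSpace Λ]
    {μ : Measure Λ} {ν : Measure α} [SFinite ν] {π : Measure β} {T : Λ → α → β}
    (hT : MeasurePreserving (uncurry T) (μ.prod ν) π) :
    ∀ᵐ l ∂μ, MapsTo (T l) (atoms ν) (atoms π) := by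
  have hπ : ∀ᵐ b ∂π, b ∈ atoms π := ae_iff_of_countable.2 fun _ ↦ id
  filter_upwards [Measure.ae_ae_of_ae_prod (hT.quasiMeasurePreserving.ae hπ)] with l hl
  exact ae_iff_of_countable.1 hl

theorem IsMonoMixture.finite_atoms [Countable α] [Countable β] [LinearOrder α] [Preorder β]
    {ν : Measure α} [SFinite ν] {π : Measure β} (h : IsMonoMixture π ν) (hπ : (atoms π).Finite) :
    (atoms ν).Finite := by
  obtain ⟨Λ, _, μ, _, T, hT, hmono⟩ := h
  obtain ⟨l, hl, hmaps⟩ := (hmono.and (ae_mapsTo_atoms hT)).exists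
  exact hπ.of_injOn hmaps hl.injOn

theorem IsMonoMixture.trans [Countable α] [Countable β] [Preorder α] [Preorder β] [Preorder γ]
    {ν : Measure α} {ρ : Measure β} {π : Measure γ} [SFinite ν]
    (hπ : IsMonoMixture π ρ) (hρ : IsMonoMixture ρ ν) : IsMonoMixture π ν := by
  obtain ⟨Λ, _, μ, _, T, hT, hTmono⟩ := hπ
  obtain ⟨Λ', _, μ', _, S, hS, hSmono⟩ := hρ
  refine ⟨Λ × Λ', inferInstance, μ.prod μ', inferInstance, fun l a ↦ T l.1 (S l.2 a),
    hT.comp (((MeasurePreserving.id μ).prod hS).comp (measurePreserving_prodAssoc μ μ' ν)), ?_⟩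
  filter_upwards [Measure.quasiMeasurePreserving_fst.ae hTmono,
    Measure.quasiMeasurePreserving_snd.ae hSmono,
    Measure.quasiMeasurePreserving_snd.ae (ae_mapsTo_atoms hS)] with l hT hS hmaps
  exact hT.comp hS hmaps

theorem measurePreserving_prodProdProdComm (μ : Measure α) (ν : Measure β) (ρ : Measure γ)
    (τ : Measure δ) [SFinite μ] [SFinite ν] [SFinite ρ] [SFinite τ] :
    MeasurePreserving (fun p : (α × β) × γ × δ ↦ ((p.1.1, p.2.1), (p.1.2, p.2.2)))
      ((μ.prod ν).prod (ρ.prod τ)) ((μ.prod ρ).prod (ν.prod τ)) := by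
  have inner : MeasurePreserving (fun p : β × γ × δ ↦ (p.2.1, p.1, p.2.2))
      (ν.prod (ρ.prod τ)) (ρ.prod (ν.prod τ)) :=
    (measurePreserving_prodAssoc ρ ν τ).comp
      ((Measure.measurePreserving_swap.prod (.id τ)).comp
        ((measurePreserving_prodAssoc ν ρ τ).symm _))
  exact ((measurePreserving_prodAssoc μ ρ (ν.prod τ)).symm _).comp
    (((MeasurePreserving.id μ).prod inner).comp (measurePreserving_prodAssoc μ ν (ρ.prod τ)))

theorem IsMonoMixture.prod [PartialOrder α] [PartialOrder β] [Preorder γ] [Preorder δ]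
    {ν₁ : Measure α} {ν₂ : Measure β} {π₁ : Measure γ} {π₂ : Measure δ} [SFinite ν₁] [SFinite ν₂]
    (h₁ : IsMonoMixture π₁ ν₁) (h₂ : IsMonoMixture π₂ ν₂) :
    IsMonoMixture (π₁.prod π₂) (ν₁.prod ν₂) := by
  obtain ⟨Λ₁, _, μ₁, _, T₁, hT₁, hmono₁⟩ := h₁
  obtain ⟨Λ₂, _, μ₂, _, T₂, hT₂, hmono₂⟩ := h₂
  refine ⟨Λ₁ × Λ₂, inferInstance, μ₁.prod μ₂, inferInstance, fun l ↦ Prod.map (T₁ l.1) (T₂ l.2),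
    (hT₁.prod hT₂).comp (measurePreserving_prodProdProdComm μ₁ μ₂ ν₁ ν₂), ?_⟩
  filter_upwards [Measure.quasiMeasurePreserving_fst.ae hmono₁,
    Measure.quasiMeasurePreserving_snd.ae hmono₂] with l h₁ h₂
  rw [atoms_prod]
  rintro ⟨a, b⟩ ⟨ha, hb⟩ ⟨a', b'⟩ ⟨ha', hb'⟩ hlt
  rcases Prod.mk_lt_mk.1 hlt with ⟨haa', hbb'⟩ | ⟨haa', hbb'⟩
  · exact Prod.mk_lt_mk.2 <| .inl ⟨h₁ ha ha' haa', h₂.monotoneOn hb hb' hbb'⟩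
  · exact Prod.mk_lt_mk.2 <| .inr ⟨h₁.monotoneOn ha ha' haa', h₂ hb hb' hbb'⟩

end MonoMixture

section QuantileCoupling

theorem measurePreserving_quantile_kernel (μ : Measure ℤ) [SFinite μ] (κ : Kernel ℤ ℤ)
    [IsMarkovKernel κ] :
    MeasurePreserving (fun p : I × ℤ ↦ (p.2, quantile (κ p.2) p.1)) (volume.prod μ) (μ ⊗ₘ κ) := by
  have hmeas : Measurable fun p : I × ℤ ↦ (p.2, quantile (κ p.2) p.1) :=
    measurable_snd.prodMk (measurable_from_prod_countable_left fun r ↦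
      measurable_quantile (ρ := κ r))
  refine ⟨hmeas, Measure.ext fun s hs ↦ ?_⟩
  rw [Measure.map_apply hmeas hs, Measure.prod_apply_symm (hmeas hs), Measure.compProd_apply hs]
  refine lintegral_congr fun r ↦ ?_
  conv_rhs => rw [← map_quantile (ρ := κ r),
    Measure.map_apply measurable_quantile (measurable_prodMk_left hs)]
  rfl

variable {ν₁ ν₂ : Measure ℤ} [IsProbabilityMeasure ν₁] [IsProbabilityMeasure ν₂]

/-- The conditional law of the second of two independent variables of laws `ν₁` and `ν₂`, given
their sum. -/
noncomputable def condGivenSum (ν₁ ν₂ : Measure ℤ) [IsProbabilityMeasure ν₁]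
    [IsProbabilityMeasure ν₂] : Kernel ℤ ℤ :=
  ((ν₁.prod ν₂).map fun p ↦ (p.1 + p.2, p.2)).condKernel

instance : IsMarkovKernel (condGivenSum ν₁ ν₂) := by
  unfold condGivenSum
  infer_instance

instance : ((ν₁.prod ν₂).map fun p ↦ (p.1 + p.2, p.2)).IsCondKernel (condGivenSum ν₁ ν₂) := by
  unfold condGivenSum
  infer_instance

theorem compProd_condGivenSum :
    (ν₁ ∗ ν₂) ⊗ₘ condGivenSum ν₁ ν₂ = (ν₁.prod ν₂).map fun p ↦ (p.1 + p.2, p.2) := by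
  have h := ((ν₁.prod ν₂).map fun p ↦ (p.1 + p.2, p.2)).disintegrate (condGivenSum ν₁ ν₂)
  rwa [Measure.fst_map_prodMk measurable_snd] at h

theorem conv_mul_condGivenSum (r j : ℤ) :
    (ν₁ ∗ ν₂) {r} * condGivenSum ν₁ ν₂ r {j} = ν₁ {r - j} * ν₂ {j} := by
  have hpre : (fun p : ℤ × ℤ ↦ (p.1 + p.2, p.2)) ⁻¹' {(r, j)} = {r - j} ×ˢ {j} := by
    ext ⟨x, y⟩
    simp only [mem_preimage, mem_singleton_iff, Prod.mk.injEq, singleton_prod_singleton]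
    omega
  calc (ν₁ ∗ ν₂) {r} * condGivenSum ν₁ ν₂ r {j}
      = ((ν₁ ∗ ν₂) ⊗ₘ condGivenSum ν₁ ν₂) ({r} ×ˢ {j}) := by
        rw [Measure.compProd_apply_prod (by simp) (by simp), lintegral_singleton, mul_comm]
    _ = ν₁ {r - j} * ν₂ {j} := by
        rw [compProd_condGivenSum, singleton_prod_singleton,
          Measure.map_apply (by fun_prop) (by simp), hpre, Measure.prod_prod]

theorem condGivenSum_mul_le_mul {r r' x y x' y' : ℤ} (hr : r ∈ atoms (ν₁ ∗ ν₂))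
    (hr' : r' ∈ atoms (ν₁ ∗ ν₂))
    (h : ν₁ {r' - x} * ν₂ {x} * (ν₁ {r - y} * ν₂ {y}) ≤
      ν₁ {r - x'} * ν₂ {x'} * (ν₁ {r' - y'} * ν₂ {y'})) :
    condGivenSum ν₁ ν₂ r' {x} * condGivenSum ν₁ ν₂ r {y} ≤
      condGivenSum ν₁ ν₂ r {x'} * condGivenSum ν₁ ν₂ r' {y'} := by
  simp only [← conv_mul_condGivenSum] at h
  refine (ENNReal.mul_le_mul_iff_right (mul_ne_zero hr hr')
    (ENNReal.mul_ne_top (measure_ne_top _ _) (measure_ne_top _ _))).1 ?_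
  convert h using 1 <;> ring

theorem quantile_condGivenSum_mono (h₁ : IsLogConcaveMeasure ν₁) {u : I} (hu : u ∈ Ioo (0 : I) 1) :
    MonotoneOn (fun r ↦ quantile (condGivenSum ν₁ ν₂ r) u) (atoms (ν₁ ∗ ν₂)) := by
  intro r hr r' hr' hrr'
  suffices quantile (condGivenSum ν₁ ν₂ r) u ≤ quantile (condGivenSum ν₁ ν₂ r') u + 0 by
    simpa only [add_zero] using this
  refine quantile_le_quantile_add (measure_Iic_le_of_mul_le_mul 0 fun x y hxy ↦ ?_) hu
  simp only [add_zero]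
  refine condGivenSum_mul_le_mul hr hr' ?_
  calc ν₁ {r' - x} * ν₂ {x} * (ν₁ {r - y} * ν₂ {y})
      = ν₁ {r - y} * ν₁ {r' - x} * (ν₂ {x} * ν₂ {y}) := by ring
    _ ≤ ν₁ {r - x} * ν₁ {r' - y} * (ν₂ {x} * ν₂ {y}) :=
        mul_le_mul' (h₁ (by omega) (by omega) (by omega)) le_rfl
    _ = ν₁ {r - x} * ν₂ {x} * (ν₁ {r' - y} * ν₂ {y}) := by ring

theorem sub_quantile_condGivenSum_mono (h₂ : IsLogConcaveMeasure ν₂) {u : I}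
    (hu : u ∈ Ioo (0 : I) 1) :
    MonotoneOn (fun r ↦ r - quantile (condGivenSum ν₁ ν₂ r) u) (atoms (ν₁ ∗ ν₂)) := by
  intro r hr r' hr' hrr'
  suffices quantile (condGivenSum ν₁ ν₂ r') u ≤ quantile (condGivenSum ν₁ ν₂ r) u + (r' - r) by
    dsimp only
    omega
  refine quantile_le_quantile_add (measure_Iic_le_of_mul_le_mul _ fun x y hxy ↦ ?_) hu
  refine condGivenSum_mul_le_mul hr' hr ?_
  rw [show r' - (y + (r' - r)) = r - y by ring, show r' - (x + (r' - r)) = r - x by ring]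
  calc ν₁ {r - x} * ν₂ {x} * (ν₁ {r - y} * ν₂ {y + (r' - r)})
      = ν₁ {r - x} * ν₁ {r - y} * (ν₂ {x} * ν₂ {y + (r' - r)}) := by ring
    _ ≤ ν₁ {r - x} * ν₁ {r - y} * (ν₂ {x + (r' - r)} * ν₂ {y}) :=
        mul_le_mul' le_rfl (h₂ (by omega) (by omega) (by omega))
    _ = ν₁ {r - x} * ν₂ {x + (r' - r)} * (ν₁ {r - y} * ν₂ {y}) := by ring

theorem IsLogConcaveMeasure.isMonoMixture_prod_conv (h₁ : IsLogConcaveMeasure ν₁)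
    (h₂ : IsLogConcaveMeasure ν₂) : IsMonoMixture (ν₁.prod ν₂) (ν₁ ∗ ν₂) := by
  have unshear : MeasurePreserving (fun p : ℤ × ℤ ↦ (p.1 - p.2, p.2))
      ((ν₁ ∗ ν₂) ⊗ₘ condGivenSum ν₁ ν₂) (ν₁.prod ν₂) := by
    refine ⟨by fun_prop, ?_⟩
    rw [compProd_condGivenSum, Measure.map_map (by fun_prop) (by fun_prop)]
    simp [comp_def]
  refine ⟨I, inferInstance, volume, inferInstance,
    fun u r ↦ (r - quantile (condGivenSum ν₁ ν₂ r) u, quantile (condGivenSum ν₁ ν₂ r) u),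
    unshear.comp (measurePreserving_quantile_kernel _ _), ?_⟩
  filter_upwards [ae_mem_Ioo_zero_one] with u hu r hr r' hr' hrr'
  have hfst := sub_quantile_condGivenSum_mono h₂ hu hr hr' hrr'.le
  have hsnd := quantile_condGivenSum_mono h₁ hu hr hr' hrr'.le
  refine lt_of_le_of_ne ⟨hfst, hsnd⟩ fun heq ↦ hrr'.ne ?_
  simpa using congrArg (fun p : ℤ × ℤ ↦ p.1 + p.2) heq

theorem IsMonoMixture.conv {π₁ π₂ : Measure ℤ} (hπ₁ : IsMonoMixture π₁ ν₁)
    (hπ₂ : IsMonoMixture π₂ ν₂) (h₁ : IsLogConcaveMeasure ν₁) (h₂ : IsLogConcaveMeasure ν₂) :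
    IsMonoMixture (π₁ ∗ π₂) (ν₁ ∗ ν₂) := by
  have hadd : IsMonoMixture (π₁ ∗ π₂) (π₁.prod π₂) :=
    .of_strictMonoOn ⟨measurable_add, rfl⟩ fun p _ q _ hpq ↦ by
      rcases Prod.lt_iff.1 hpq with ⟨h, h'⟩ | ⟨h, h'⟩
      · exact add_lt_add_of_lt_of_le h h'
      · exact add_lt_add_of_le_of_lt h h'
  exact (hadd.trans (hπ₁.prod hπ₂)).trans (h₁.isMonoMixture_prod_conv h₂)

end QuantileCoupling

section Majorization

variable {ι κ : Type*}

/-- `g` is majorized by `w`: every convex function on `[0, ∞)` vanishing at `0` has a smaller sum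
along `g` than along `w`. The sums are meaningful for finitely supported `g` and `w`. -/
def IsMajorizedBy (g : κ → ℝ) (w : ι → ℝ) : Prop :=
  ∀ φ : ℝ → ℝ, ConvexOn ℝ (Ici 0) φ → φ 0 = 0 → ∑' a, φ (g a) ≤ ∑' r, φ (w r)

theorem tsum_comp_eq_sum {f : ι → ℝ} {φ : ℝ → ℝ} (hφ : φ 0 = 0) {S : Finset ι}
    (hS : support f ⊆ S) : ∑' x, φ (f x) = ∑ x ∈ S, φ (f x) :=
  tsum_eq_sum fun x hx ↦ by rw [notMem_support.1 fun h ↦ hx (hS h), hφ]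

theorem isMajorizedBy_of_substochastic {S : Finset ι} {G : Finset κ} {w : ι → ℝ} {g : κ → ℝ}
    (hS : support w ⊆ S) (hG : support g ⊆ G) (hw : ∀ r, 0 ≤ w r) {M : ι → κ → ℝ}
    (hM : ∀ r a, 0 ≤ M r a) (hrow : ∀ r ∈ S, ∑ a ∈ G, M r a = 1)
    (hcol : ∀ a, ∑ r ∈ S, M r a ≤ 1) (hg : ∀ a, g a = ∑ r ∈ S, M r a * w r) :
    IsMajorizedBy g w := by
  intro φ hφ hφ₀
  rw [tsum_comp_eq_sum hφ₀ hS, tsum_comp_eq_sum hφ₀ hG]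
  have jensen (a : κ) : φ (g a) ≤ ∑ r ∈ S, M r a * φ (w r) := by
    have := hφ.map_add_sum_le (t := S) (w := (M · a)) (p := w) (v := 1 - ∑ r ∈ S, M r a) (q := 0)
      (fun r _ ↦ hM r a) (by ring) (fun r _ ↦ hw r) (sub_nonneg.2 (hcol a)) self_mem_Ici
    simpa [hφ₀, hg] using this
  calc ∑ a ∈ G, φ (g a) ≤ ∑ a ∈ G, ∑ r ∈ S, M r a * φ (w r) := Finset.sum_le_sum fun a _ ↦ jensen a
    _ = ∑ r ∈ S, (∑ a ∈ G, M r a) * φ (w r) := by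
        simp only [Finset.sum_comm (s := G), Finset.sum_mul]
    _ = ∑ r ∈ S, φ (w r) := Finset.sum_congr rfl fun r hr ↦ by rw [hrow r hr, one_mul]

variable {α β Λ : Type*} [MeasurableSpace β] [MeasurableSingletonClass β] [MeasurableSpace Λ]
  {μ : Measure Λ} [IsProbabilityMeasure μ] {T : Λ → α → β}

theorem sum_measureReal_fiber_eq_one {f : Λ → β} (hf : Measurable f) {G : Finset β}
    (hfG : ∀ᵐ l ∂μ, f l ∈ G) : ∑ a ∈ G, μ.real (f ⁻¹' {a}) = 1 := by
  rw [sum_measureReal_preimage_singleton _ fun a _ ↦ hf (measurableSet_singleton a)]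
  exact (measureReal_congr (Filter.eventuallyEq_univ.2 hfG)).trans probReal_univ

theorem sum_measureReal_fiber_le_one {S : Finset α} (hT : ∀ r, Measurable (T · r))
    (hinj : ∀ᵐ l ∂μ, InjOn (T l) S) (a : β) : ∑ r ∈ S, μ.real ((T · r) ⁻¹' {a}) ≤ 1 := by
  have hdisj : (S : Set α).Pairwise (AEDisjoint μ on fun r ↦ (T · r) ⁻¹' {a}) := by
    intro r hr r' hr' hne
    refine measure_eq_zero_iff_ae_notMem.2 ?_
    filter_upwards [hinj] with l hl ⟨h, h'⟩
    exact hne (hl hr hr' (h.trans h'.symm))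
  rw [← measureReal_biUnion_finset₀ hdisj
    fun r _ ↦ (hT r (measurableSet_singleton a)).nullMeasurableSet]
  exact measureReal_le_one

variable [MeasurableSpace α] {ν : Measure α} [IsFiniteMeasure ν] {π : Measure β}

theorem support_measureReal_singleton (ν : Measure α) [IsFiniteMeasure ν] :
    support (fun a ↦ ν.real {a}) = atoms ν := by
  ext a
  simp [atoms, measureReal_def, ENNReal.toReal_eq_zero_iff]

theorem measureReal_singleton_eq_sum_fiber [Countable α] [MeasurableSingletonClass α]
    (hT : MeasurePreserving (uncurry T) (μ.prod ν) π) {S : Finset α} (hS : atoms ν ⊆ S) (a : β) :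
    π.real {a} = ∑ r ∈ S, μ.real ((T · r) ⁻¹' {a}) * ν.real {r} := by
  have hπ : π {a} = ∑' r, μ ((T · r) ⁻¹' {a}) * ν {r} := by
    rw [← hT.measure_preimage (measurableSet_singleton a).nullMeasurableSet,
      Measure.prod_apply_symm (hT.measurable (measurableSet_singleton a)), lintegral_countable']
    rfl
  rw [tsum_eq_sum fun r hr ↦ by rw [not_not.1 fun h ↦ hr (hS h), mul_zero]] at hπ
  rw [measureReal_def, hπ, ENNReal.toReal_sum fun r _ ↦
    ENNReal.mul_ne_top (measure_ne_top _ _) (measure_ne_top _ _)]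
  simp only [ENNReal.toReal_mul, measureReal_def]

theorem IsMonoMixture.isMajorizedBy [Countable α] [MeasurableSingletonClass α] [Countable β]
    [LinearOrder α] [Preorder β] (h : IsMonoMixture π ν) (hπ : (atoms π).Finite) :
    IsMajorizedBy (fun a ↦ π.real {a}) (fun r ↦ ν.real {r}) := by
  have hν := h.finite_atoms hπ
  obtain ⟨Λ, _, μ, _, T, hT, hmono⟩ := h
  have : IsFiniteMeasure π := hT.map_eq ▸ inferInstance
  have hTmeas (r : α) : Measurable (T · r) := hT.measurable.comp (measurable_prodMk_right)
  refine isMajorizedBy_of_substochastic (S := hν.toFinset) (G := hπ.toFinset)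
    (M := fun r a ↦ μ.real ((T · r) ⁻¹' {a})) ?_ ?_ (fun _ ↦ measureReal_nonneg)
    (fun _ _ ↦ measureReal_nonneg) (fun r hr ↦ sum_measureReal_fiber_eq_one (hTmeas r) ?_)
    (sum_measureReal_fiber_le_one hTmeas ?_) (measureReal_singleton_eq_sum_fiber hT (by simp))
  · simp [support_measureReal_singleton]
  · simp [support_measureReal_singleton]
  · filter_upwards [ae_mapsTo_atoms hT] with l hl
    exact hπ.mem_toFinset.2 (hl (hν.mem_toFinset.1 hr))
  · filter_upwards [hmono] with l hl
    simpa using hl.injOn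

end Majorization

section RenyiEntropy

variable {f g w : ℤ → ℝ}

theorem support_eq_posSupp (hf : ∀ x, 0 ≤ f x) : support f = posSupp f :=
  Set.ext fun x ↦ (hf x).lt_iff_ne'.symm

theorem tsum_comp_eq_sum_posSupp (hf : ∀ x, 0 ≤ f x) (hfin : (posSupp f).Finite) {φ : ℝ → ℝ}
    (hφ : φ 0 = 0) : ∑' x, φ (f x) = ∑ x ∈ hfin.toFinset, φ (f x) :=
  tsum_comp_eq_sum hφ (by simp [support_eq_posSupp hf])

theorem bddAbove_range_of_finite_posSupp (hf : ∀ x, 0 ≤ f x) (hfin : (posSupp f).Finite) :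
    BddAbove (range f) := by
  refine (((hfin.image f).insert 0).subset ?_).bddAbove
  rintro _ ⟨x, rfl⟩
  exact (hf x).eq_or_lt.imp Eq.symm (mem_image_of_mem f)

theorem tsum_rpow_pos (hf : ∀ x, 0 ≤ f x) (hfin : (posSupp f).Finite) (hne : (posSupp f).Nonempty)
    {p : ℝ} (hp : 0 < p) : 0 < ∑' x, f x ^ p := by
  rw [tsum_comp_eq_sum_posSupp hf hfin (φ := (· ^ p)) (Real.zero_rpow hp.ne')]
  exact Finset.sum_pos (fun x hx ↦ Real.rpow_pos_of_pos (hfin.mem_toFinset.1 hx) p)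
    (hfin.toFinset_nonempty.2 hne)

theorem convexOn_Ici_ite_eq_zero :
    ConvexOn ℝ (Ici 0) fun x : ℝ ↦ if x = 0 then (0 : ℝ) else -1 := by
  refine ⟨convex_Ici 0, fun x hx y hy a b ha hb hab ↦ ?_⟩
  simp only [smul_eq_mul]
  by_cases h : a * x + b * y = 0
  · obtain ⟨hax, hby⟩ := (add_eq_zero_iff_of_nonneg (mul_nonneg ha hx) (mul_nonneg hb hy)).1 h
    rcases mul_eq_zero.1 hax with rfl | rfl <;> rcases mul_eq_zero.1 hby with rfl | rfl <;> simp_all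
  · rw [if_neg h]
    split_ifs <;> linarith

namespace IsMajorizedBy

theorem ncard_posSupp_le (h : IsMajorizedBy g w) (hg : ∀ x, 0 ≤ g x) (hw : ∀ x, 0 ≤ w x)
    (hgfin : (posSupp g).Finite) (hwfin : (posSupp w).Finite) :
    (posSupp w).ncard ≤ (posSupp g).ncard := by
  have count {f : ℤ → ℝ} (hf : ∀ x, 0 ≤ f x) (hfin : (posSupp f).Finite) :
      ∑' x, (if f x = 0 then (0 : ℝ) else -1) = -(posSupp f).ncard := by
    rw [tsum_comp_eq_sum_posSupp hf hfin (φ := fun x ↦ if x = 0 then 0 else -1) (if_pos rfl),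
      Finset.sum_congr rfl fun x hx ↦ if_neg (hfin.mem_toFinset.1 hx).ne', Finset.sum_const,
      ncard_eq_toFinset_card _ hfin, nsmul_eq_mul, mul_neg_one]
  have := h _ convexOn_Ici_ite_eq_zero (if_pos rfl)
  rw [count hg hgfin, count hw hwfin] at this
  exact_mod_cast neg_le_neg_iff.1 this

theorem nonempty_posSupp (h : IsMajorizedBy g w) (hg : ∀ x, 0 ≤ g x) (hw : ∀ x, 0 ≤ w x)
    (hgfin : (posSupp g).Finite) (hwfin : (posSupp w).Finite) (hne : (posSupp w).Nonempty) :
    (posSupp g).Nonempty :=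
  (ncard_pos hgfin).1 (((ncard_pos hwfin).2 hne).trans_le (h.ncard_posSupp_le hg hw hgfin hwfin))

theorem le_iSup (h : IsMajorizedBy g w) (hg : ∀ x, 0 ≤ g x) (hw : ∀ x, 0 ≤ w x)
    (hgfin : (posSupp g).Finite) (hwfin : (posSupp w).Finite) (a : ℤ) : g a ≤ ⨆ r, w r := by
  set m := ⨆ r, w r
  have hφ : ConvexOn ℝ (Ici 0) fun x ↦ max (x - m) 0 :=
    ((convexOn_id (convex_Ici 0)).sub (concaveOn_const m (convex_Ici 0))).sup
      (convexOn_const 0 (convex_Ici 0))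
  have hφ₀ : max (0 - m) 0 = 0 := by simpa using Real.iSup_nonneg hw
  have hwm (r : ℤ) : max (w r - m) 0 = 0 :=
    max_eq_right (sub_nonpos.2 (le_ciSup (bddAbove_range_of_finite_posSupp hw hwfin) r))
  have hsum : Summable fun a ↦ max (g a - m) 0 :=
    summable_of_hasFiniteSupport (hgfin.subset fun a ha ↦
      support_eq_posSupp hg ▸ fun h0 ↦ ha (by simpa only [h0] using hφ₀))
  have := (hsum.le_tsum a fun _ _ ↦ le_max_right _ _).trans (h _ hφ hφ₀)
  simpa only [hwm, tsum_zero, max_le_iff, sub_nonpos, le_refl, and_true] using this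

theorem renyiEntropyOfMass_le (h : IsMajorizedBy g w) (hg : ∀ x, 0 ≤ g x) (hw : ∀ x, 0 ≤ w x)
    (hgfin : (posSupp g).Finite) (hwfin : (posSupp w).Finite) (hne : (posSupp w).Nonempty)
    (α : ℝ≥0∞) : renyiEntropyOfMass α w ≤ renyiEntropyOfMass α g := by
  have hgne := h.nonempty_posSupp hg hw hgfin hwfin hne
  unfold renyiEntropyOfMass
  split_ifs with h₀ h₁ h₂
  · exact Real.log_le_log (by exact_mod_cast (ncard_pos hwfin).2 hne)
      (by exact_mod_cast h.ncard_posSupp_le hg hw hgfin hwfin)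
  · simpa only [tsum_neg, neg_le_neg_iff] using h _ Real.convexOn_mul_log (by simp)
  · obtain ⟨a, ha⟩ := hgne
    have hpos : 0 < ⨆ i, g i :=
      lt_of_lt_of_le ha (le_ciSup (bddAbove_range_of_finite_posSupp hg hgfin) a)
    exact neg_le_neg (Real.log_le_log hpos (ciSup_le (h.le_iSup hg hw hgfin hwfin)))
  · have hα₀ : 0 < α.toReal := ENNReal.toReal_pos h₀ h₂
    have hα₁ : α.toReal ≠ 1 := mt (ENNReal.toReal_eq_one_iff α).1 h₁
    rcases hα₁.lt_or_gt with hlt | hgt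
    · have hsum := h _ (Real.concaveOn_rpow hα₀.le hlt.le).neg (by simp [hα₀.ne'])
      simp only [Pi.neg_apply, tsum_neg, neg_le_neg_iff] at hsum
      exact mul_le_mul_of_nonneg_left (Real.log_le_log (tsum_rpow_pos hw hwfin hne hα₀) hsum)
        (one_div_nonneg.2 (sub_nonneg.2 hlt.le))
    · have hsum := h _ (convexOn_rpow hgt.le) (Real.zero_rpow hα₀.ne')
      exact mul_le_mul_of_nonpos_left (Real.log_le_log (tsum_rpow_pos hg hgfin hgne hα₀) hsum)
        (one_div_nonpos.2 (sub_nonpos.2 hgt.le))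

end IsMajorizedBy

end RenyiEntropy

section HashFun

variable {f : ℤ → ℝ} (hf : (posSupp f).Finite)

theorem hashFun_natCast (r : Fin hf.toFinset.card) :
    hashFun f hf (r : ℕ) = f (hf.toFinset.orderEmbOfFin rfl r) := by
  simp [hashFun, Fin.val_inj]

theorem orderEmbOfFin_mem_posSupp (r : Fin hf.toFinset.card) :
    hf.toFinset.orderEmbOfFin rfl r ∈ posSupp f :=
  hf.mem_toFinset.1 (hf.toFinset.orderEmbOfFin_mem rfl r)

theorem hashFun_nonneg (k : ℤ) : 0 ≤ hashFun f hf k :=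
  Finset.sum_nonneg fun r _ ↦ ite_nonneg (orderEmbOfFin_mem_posSupp hf r).le le_rfl

theorem exists_fin_of_hashFun_ne_zero {k : ℤ} (hk : hashFun f hf k ≠ 0) :
    ∃ r : Fin hf.toFinset.card, ((r : ℕ) : ℤ) = k := by
  obtain ⟨r, -, hr⟩ := Finset.exists_ne_zero_of_sum_ne_zero hk
  exact ⟨r, (ite_ne_right_iff.1 hr).1.symm⟩

theorem posSupp_hashFun : posSupp (hashFun f hf) = Ico 0 (hf.toFinset.card : ℤ) := by
  ext k
  refine ⟨fun hk ↦ ?_, fun hk ↦ ?_⟩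
  · obtain ⟨r, rfl⟩ := exists_fin_of_hashFun_ne_zero hf (ne_of_gt hk)
    exact ⟨by omega, by omega⟩
  · lift k to ℕ using hk.1
    let r : Fin hf.toFinset.card := ⟨k, Int.ofNat_lt.1 hk.2⟩
    exact (orderEmbOfFin_mem_posSupp hf r).trans_eq (hashFun_natCast hf r).symm

variable {hf} {ν π : Measure ℤ} [IsFiniteMeasure ν] [IsFiniteMeasure π]

theorem IsHashLogConcave.isLogConcaveMeasure (hlc : IsHashLogConcave f hf)
    (hν : ∀ k, ν.real {k} = hashFun f hf k) : IsLogConcaveMeasure ν := by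
  intro a b c d hab hbd hsum
  have hreal := IsLogConcaveInt.mul_le_mul_of_add_eq_add hlc (hashFun_nonneg hf)
    (posSupp_hashFun hf ▸ ordConnected_Ico) hab hbd hsum
  simp only [← hν, measureReal_def, ← ENNReal.toReal_mul] at hreal
  exact (ENNReal.toReal_le_toReal (by finiteness) (by finiteness)).1 hreal

theorem isMonoMixture_of_hashFun (hπ : ∀ k, π.real {k} = f k)
    (hν : ∀ k, ν.real {k} = hashFun f hf k) : IsMonoMixture π ν := by
  let e := hf.toFinset.orderEmbOfFin rfl
  let i : Fin hf.toFinset.card → ℤ := fun r ↦ (r : ℕ)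
  have hi : Injective i := Nat.cast_injective.comp Fin.val_injective
  let t : ℤ → ℤ := extend i e 0
  have ht (r) : t (i r) = e r := hi.extend_apply e 0 r
  have hatoms {k : ℤ} (hk : k ∈ atoms ν) : ∃ r, i r = k := by
    rw [← support_measureReal_singleton, mem_support, hν] at hk
    exact exists_fin_of_hashFun_ne_zero hf hk
  have hmass (r) : π {e r} = ν {i r} := by
    rw [← measureReal_eq_measureReal_iff, hπ, hν]
    exact (hashFun_natCast hf r).symm
  have hmono : StrictMonoOn t (atoms ν) := by
    intro k hk k' hk' hkk'
    obtain ⟨r, rfl⟩ := hatoms hk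
    obtain ⟨r', rfl⟩ := hatoms hk'
    rw [ht, ht]
    exact e.strictMono (Int.ofNat_lt.1 hkk')
  refine .of_strictMonoOn (measurePreserving_of_injOn_atoms .of_discrete hmono.injOn
    (fun k hk ↦ ?_) fun b hb ↦ ?_) hmono
  · obtain ⟨r, rfl⟩ := hatoms hk
    rw [ht, hmass]
  · have hb' : b ∈ posSupp f := by
      rw [← support_measureReal_singleton, funext hπ] at hb
      rwa [← support_eq_posSupp fun k ↦ hπ k ▸ measureReal_nonneg]
    obtain ⟨r, rfl⟩ : b ∈ range e := by simpa [e] using hb'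
    exact ⟨i r, ((hmass r).symm.trans_ne hb :), ht r⟩

end HashFun

section Sums

theorem nonempty_atoms {α : Type*} [MeasurableSpace α] [Countable α] (ν : Measure α)
    [IsProbabilityMeasure ν] : (atoms ν).Nonempty :=
  (ae_iff_of_countable.2 fun _ ↦ id : ∀ᵐ a ∂ν, a ∈ atoms ν).exists

theorem atoms_conv_subset (ν₁ ν₂ : Measure ℤ) [SFinite ν₁] [SFinite ν₂] :
    atoms (ν₁ ∗ ν₂) ⊆ atoms ν₁ + atoms ν₂ := by
  intro r hr
  obtain ⟨j, hj⟩ : ∃ j, ν₁ {r - j} * ν₂ {j} ≠ 0 := by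
    by_contra! h
    exact hr (by rw [conv_singleton, ENNReal.tsum_eq_zero.2 h])
  exact ⟨r - j, left_ne_zero_of_mul hj, j, right_ne_zero_of_mul hj, sub_add_cancel r j⟩

variable {ι Ω Ω' : Type*} [MeasurableSpace Ω] [MeasurableSpace Ω'] {P : Measure Ω}
  {Q : Measure Ω'} {X : ι → Ω → ℤ} {Y : ι → Ω' → ℤ}

theorem massFun_eq {Z : Ω → ℤ} (hZ : Measurable Z) :
    massFun P Z = fun k ↦ (P.map Z).real {k} :=
  funext fun k ↦ (map_measureReal_apply hZ (measurableSet_singleton k)).symm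

theorem posSupp_massFun [IsFiniteMeasure P] {Z : Ω → ℤ} (hZ : Measurable Z) :
    posSupp (massFun P Z) = atoms (P.map Z) := by
  rw [← support_eq_posSupp (f := massFun P Z) fun _ ↦ measureReal_nonneg,
    massFun_eq hZ, support_measureReal_singleton]

theorem map_sum_empty (P : Measure Ω) [IsProbabilityMeasure P] (X : ι → Ω → ℤ) :
    P.map (∑ i ∈ ∅, X i) = Measure.dirac 0 := by
  rw [Finset.sum_empty, Pi.zero_def, Measure.map_const, measure_univ, one_smul]

theorem map_sum_insert [DecidableEq ι] (hX : ∀ i, Measurable (X i)) (hind : iIndepFun X P)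
    {s : Finset ι} {i : ι} (hi : i ∉ s) :
    P.map (∑ j ∈ insert i s, X j) = P.map (X i) ∗ P.map (∑ j ∈ s, X j) := by
  have := hind.isProbabilityMeasure
  rw [Finset.sum_insert hi]
  exact (hind.indepFun_finsetSum_of_notMem hX hi).symm.map_add_eq_map_conv_map (hX i)
    (by fun_prop)

theorem isLogConcaveMeasure_map_sum (hY : ∀ i, Measurable (Y i)) (hind : iIndepFun Y Q)
    (h : ∀ i, IsLogConcaveMeasure (Q.map (Y i))) (s : Finset ι) :
    IsLogConcaveMeasure (Q.map (∑ i ∈ s, Y i)) := by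
  classical
  have := hind.isProbabilityMeasure
  induction s using Finset.induction_on with
  | empty =>
    rw [map_sum_empty]
    exact isLogConcaveMeasure_dirac_zero
  | insert i s hi ih =>
    rw [map_sum_insert hY hind hi]
    exact (h i).conv ih

theorem finite_atoms_map_sum (hX : ∀ i, Measurable (X i)) (hind : iIndepFun X P)
    (h : ∀ i, (atoms (P.map (X i))).Finite) (s : Finset ι) :
    (atoms (P.map (∑ i ∈ s, X i))).Finite := by
  classical
  have := hind.isProbabilityMeasure
  induction s using Finset.induction_on with
  | empty =>
    rw [map_sum_empty]
    exact (finite_singleton 0).subset fun a ha ↦ by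
      simpa [atoms, Pi.single_apply, eq_comm] using ha
  | insert i s hi ih =>
    rw [map_sum_insert hX hind hi]
    exact ((h i).add ih).subset (atoms_conv_subset _ _)

theorem isMonoMixture_map_sum (hX : ∀ i, Measurable (X i)) (hXind : iIndepFun X P)
    (hY : ∀ i, Measurable (Y i)) (hYind : iIndepFun Y Q)
    (hlc : ∀ i, IsLogConcaveMeasure (Q.map (Y i)))
    (hmix : ∀ i, IsMonoMixture (P.map (X i)) (Q.map (Y i))) (s : Finset ι) :
    IsMonoMixture (P.map (∑ i ∈ s, X i)) (Q.map (∑ i ∈ s, Y i)) := by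
  classical
  have := hXind.isProbabilityMeasure
  have := hYind.isProbabilityMeasure
  have (i : ι) : IsProbabilityMeasure (Q.map (Y i)) :=
    Measure.isProbabilityMeasure_map (hY i).aemeasurable
  have (s : Finset ι) : IsProbabilityMeasure (Q.map (∑ i ∈ s, Y i)) :=
    Measure.isProbabilityMeasure_map (by fun_prop)
  induction s using Finset.induction_on with
  | empty =>
    rw [map_sum_empty, map_sum_empty]
    exact .of_strictMonoOn (.id _) strictMonoOn_id
  | insert i s hi ih =>
    rw [map_sum_insert hX hXind hi, map_sum_insert hY hYind hi]
    exact (hmix i).conv ih (hlc i) (isLogConcaveMeasure_map_sum hY hYind hlc s)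

theorem IsMonoMixture.renyiEntropy_le [IsFiniteMeasure P] [IsProbabilityMeasure Q]
    {U : Ω → ℤ} {V : Ω' → ℤ} (hU : Measurable U) (hV : Measurable V)
    (h : IsMonoMixture (P.map U) (Q.map V)) (hfin : (atoms (P.map U)).Finite) (α : ℝ≥0∞) :
    renyiEntropy α Q V ≤ renyiEntropy α P U := by
  have := Measure.isProbabilityMeasure_map (μ := Q) hV.aemeasurable
  have hmaj : IsMajorizedBy (massFun P U) (massFun Q V) := by
    rw [massFun_eq hU, massFun_eq hV]
    exact h.isMajorizedBy hfin
  refine hmaj.renyiEntropyOfMass_le (fun _ ↦ measureReal_nonneg) (fun _ ↦ measureReal_nonneg)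
    ?_ ?_ ?_ α
  · rwa [posSupp_massFun hU]
  · rw [posSupp_massFun hV]
    exact h.finite_atoms hfin
  · rw [posSupp_massFun hV]
    exact nonempty_atoms _

end Sums

theorem mainTheorem3 {Ω Ω' : Type*} [MeasurableSpace Ω] [MeasurableSpace Ω']
    (P : Measure Ω) [IsProbabilityMeasure P] (Q : Measure Ω') [IsProbabilityMeasure Q]
    (N : ℕ) (X : Fin N → Ω → ℤ) (Xhash : Fin N → Ω' → ℤ)
    (hXmeas : ∀ i, Measurable (X i))
    (hXindep : iIndepFun X P)
    (hXfin : ∀ i, (posSupp (massFun P (X i))).Finite)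
    (hXlc : ∀ i, IsHashLogConcave (massFun P (X i)) (hXfin i))
    (hYmeas : ∀ i, Measurable (Xhash i))
    (hYindep : iIndepFun Xhash Q)
    (hYmass : ∀ i, massFun Q (Xhash i) = hashFun (massFun P (X i)) (hXfin i))
    (α : ℝ≥0∞) :
    renyiEntropy α Q (fun ω => ∑ i, Xhash i ω) ≤ renyiEntropy α P (fun ω => ∑ i, X i ω) := by
  have hX (i) (k : ℤ) : (P.map (X i)).real {k} = massFun P (X i) k := by
    rw [massFun_eq (hXmeas i)]
  have hY (i) (k : ℤ) : (Q.map (Xhash i)).real {k} = hashFun (massFun P (X i)) (hXfin i) k := by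
    rw [← hYmass i, massFun_eq (hYmeas i)]
  have hmix : IsMonoMixture (P.map (∑ i, X i)) (Q.map (∑ i, Xhash i)) :=
    isMonoMixture_map_sum hXmeas hXindep hYmeas hYindep
      (fun i ↦ (hXlc i).isLogConcaveMeasure (hY i))
      (fun i ↦ isMonoMixture_of_hashFun (hX i) (hY i)) Finset.univ
  have hfin : (atoms (P.map (∑ i, X i))).Finite :=
    finite_atoms_map_sum hXmeas hXindep
      (fun i ↦ by rw [← posSupp_massFun (hXmeas i)]; exact hXfin i) Finset.univ
  simpa only [Finset.sum_fn] using hmix.renyiEntropy_le (by fun_prop) (by fun_prop) hfin α
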